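/- Let $A$ be a commutative ring with pairwise commuting derivations $\partial_1,\dots,\partial_n$, $n\ge 1$ (for instance the smooth functions on a coordinate domain, or a differential field). Consider linear differential expressions $\sum a^{\mu}_k\,y^k_\mu$ with coefficients in $A$ in the jets of $m$ unknowns $y^1,\dots,y^m$, with formal derivatives $d_i(a\,y^k_\mu)=a\,y^k_{\mu+1_i}+(\partial_i a)\,y^k_\mu$. The first order jet $y^k_i$ is said to be of class $i$. Let a first order linear system be given by the $A$-module $S$ of its equations, generated by equations in solved form, class by class, and possibly equations of order zero: for each $i=1,\dots,n$ there are a set $P_i\subseteq\{1,\dots,m\}$ and, for each $k\in P_i$, an equation $\Phi_i^k=0$ of class $i$ in which only the jets $y^l_j$ with $j\le i$ and the $y^l$ occur, $y^k_i$ has coefficient $1$, and $y^l_i$ does not occur for $l\in P_i$, $l\neq k$. The unknowns are numbered so that $P_n=\{1,\dots,\beta\}$. Assume that * the system has no zero-order equation: $0$ is the only element of $S$ in which no derivative occurs; * the system is involutive (in these coordinates): the $A$-module generated by $S$ and all $d_i f$ with $f\in S$, $1\le i\le n$, is generated by $S$ and the prolongations $d_j\Phi_i^k$ with $k\in P_i$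 with respect to the multiplicative variables $x^j$, $j\le i$. Write $\Phi_n^k=y^k_n-\sum_{l>\beta}a^k_l\,y^l_n+(\text{terms in } y^l_j,\ j<n,\ \text{and } y^l)$ for $k\le\beta$, and absorb the $y^{\beta+1}_n,\dots,y^m_n$ by introducing the new unknowns $\bar y^k=y^k-\sum_{l>\beta}a^k_l\,y^l$ for $k\le\beta$, the unknowns $y^{\beta+1},\dots,y^m$ being kept. Then: 1. This is an invertible change of unknowns: every linear differential expression in $y^1,\dots,y^m$ can be written in exactly one way as a linear differential expression in $\bar y^1,\dots,\bar y^\beta,y^{\beta+1},\dots,y^m$. 2. Rewritten in the new unknowns, each equation $\Phi_n^k=0$ of class $n$ is of order at most $1$, contains $\bar y^k_n$ with coefficient $1$ and no other $\bar y^l_n$, $l\le\beta$, and contains $y^{\beta+1},\dots,y^m$ only through the undifferentiated $y^l$ and the derivatives $y^l_i$ with $1\le i\le n-1$. 3. Rewritten in the new unknowns, each equation $\Phi_i^k=0$ of class $i\le n-1$ contains only $\bar y^1,\dots,\bar y^\beta$ and their jets $\bar y^l_j$ with $j\le i$; the unknowns $y^{\beta+1},\dots,y^m$ and their jets do not occur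 in it. -/

import Mathlib

namespace JetSystem

/-- The jet coordinates `y^k_μ` of `m` unknowns in `n` independent variables; `(k, 0)` is the
unknown `y^k` itself and `(k, single i 1)` is the first order jet `y^k_i`, which is of class `i`.
Indices start at `0`. -/
abbrev JetVar (n m : ℕ) : Type := Fin m × (Fin n →₀ ℕ)

/-- Linear differential expressions `∑ a^μ_k y^k_μ` with coefficients in `A` (the left hand sides
of linear PD equations). The value at `(k, μ)` is the coefficient of `y^k_μ`. -/
abbrev Form (A : Type*) [CommRing A] (n m : ℕ) : Type _ := JetVar n m →₀ A

section

variable {A : Type*} [CommRing A] {n m : ℕ}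

/-- The jet coordinate `y^k_i`. -/
noncomputable abbrev jet (k : Fin m) (i : Fin n) : JetVar n m := (k, Finsupp.single i 1)

/-- The unknown `y^k`, as a differential expression. -/
noncomputable def unknown (A : Type*) [CommRing A] (n : ℕ) {m : ℕ} (k : Fin m) : Form A n m :=
  Finsupp.single (k, 0) 1

/-- The formal derivative `d_i`, the additive map with
`d_i (a y^k_μ) = a y^k_{μ + 1_i} + (∂_i a) y^k_μ`. -/
noncomputable def formalDeriv (d : Fin n → Derivation ℤ A A) (i : Fin n) :
    AddMonoid.End (Form A n m) :=
  Finsupp.liftAddHom fun v : JetVar n m =>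
    Finsupp.singleAddHom (v.1, v.2 + Finsupp.single i 1) +
      (Finsupp.singleAddHom v).comp (d i : A →ₗ[ℤ] A).toAddMonoidHom

/-- The iterated formal derivative `d_μ = d_1^{μ_1} ⋯ d_n^{μ_n}`. -/
noncomputable def formalDerivIter (d : Fin n → Derivation ℤ A A) (μ : Fin n →₀ ℕ) :
    AddMonoid.End (Form A n m) :=
  ((List.finRange n).map fun i => formalDeriv d i ^ μ i).prod

/-- Substitution of the differential expressions `w^1, …, w^m` for the unknowns:
each jet coordinate `y^k_μ` is replaced by `d_μ w^k`. -/
noncomputable def subst (d : Fin n → Derivation ℤ A A) (w : Fin m → Form A n m) :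
    Form A n m →ₗ[A] Form A n m :=
  Finsupp.linearCombination A fun v : JetVar n m => formalDerivIter d v.2 (w v.1)

/-- Differential expressions of order at most `q`. -/
def orderLE (A : Type*) [CommRing A] (n m q : ℕ) : Submodule A (Form A n m) :=
  Finsupp.supported A A {v | v.2.degree ≤ q}

/-- First order expressions of class at most `i`: only the jets `y^k_j` with `j ≤ i` and the
unknowns `y^k` may occur. -/
def classLE (A : Type*) [CommRing A] {n : ℕ} (m : ℕ) (i : Fin n) : Submodule A (Form A n m) :=
  Finsupp.supported A A {v | v.2 = 0 ∨ ∃ j ≤ i, v.2 = Finsupp.single j 1}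

/-- A system is given by its module `S` of equations; it has no zero-order equation when the only
equation in which no derivative occurs is `0 = 0`. -/
def NoZeroOrderEquation (S : Submodule A (Form A n m)) : Prop :=
  ∀ f ∈ S, f ∈ orderLE A n m 0 → f = 0

/-- The equations of the first prolongation: all equations and all their formal derivatives. -/
noncomputable def prolongation (d : Fin n → Derivation ℤ A A) (S : Submodule A (Form A n m)) :
    Submodule A (Form A n m) :=
  S ⊔ Submodule.span A {f | ∃ i : Fin n, ∃ g ∈ S, f = formalDeriv d i g}

/-- The equations of a first order linear system, solved class by class. The equations of class `i`
are the `eqn i k` for `k ∈ principal i`. Such an equation is solved with respect to `y^k_i`: it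
contains `y^k_i` with coefficient `1`, the `y^l_i` for other `l ∈ principal i` do not occur in it,
and all its derivatives are of class at most `i`. The equations that remain have order zero.
(`eqn i k` is irrelevant when `k ∉ principal i`.) -/
structure SolvedForm (S : Submodule A (Form A n m)) where
  principal : Fin n → Finset (Fin m)
  eqn : Fin n → Fin m → Form A n m
  zeroOrder : Set (Form A n m)
  eqn_mem_classLE : ∀ i, ∀ k ∈ principal i, eqn i k ∈ classLE A m i
  eqn_solved : ∀ i, ∀ k ∈ principal i, ∀ l ∈ principal i,
    eqn i k (jet l i) = if l = k then 1 else 0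
  zeroOrder_subset : zeroOrder ⊆ orderLE A n m 0
  span_eq : Submodule.span A ({f | ∃ i, ∃ k ∈ principal i, f = eqn i k} ∪ zeroOrder) = S

/-- The multiplicative variables of an equation of class `i` are `x^1, …, x^i`; an equation of order
zero has none. The system is involutive when its first prolongation is obtained by prolonging the
equations with respect to their multiplicative variables only. -/
def SolvedForm.IsInvolutive {S : Submodule A (Form A n m)} (Φ : SolvedForm S)
    (d : Fin n → Derivation ℤ A A) : Prop :=
  prolongation d S =
    S ⊔ Submodule.span A
      {f | ∃ i, ∃ k ∈ Φ.principal i, ∃ j ≤ i, f = formalDeriv d j (Φ.eqn i k)}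

/-- The new unknowns after absorption. If the equation of class `ν`, the last class, solved with
respect to `y^k_ν` is `y^k_ν - ∑_{l ≥ β} a^k_l y^l_ν + ⋯ = 0`, where the dots stand for
terms of lower class or order, then `ȳ^k = y^k - ∑_{l ≥ β} a^k_l y^l` for `k < β`;
the unknowns `y^k` with `k ≥ β` are kept. -/
noncomputable def SolvedForm.newUnknown {S : Submodule A (Form A n m)} (Φ : SolvedForm S)
    (ν : Fin n) (β : ℕ) (k : Fin m) : Form A n m :=
  if (k : ℕ) < β then
    unknown A n k +
      ∑ l ∈ Finset.univ.filter (fun l : Fin m => β ≤ (l : ℕ)), Φ.eqn ν k (jet l ν) • unknown A n l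
  else unknown A n k

end

end JetSystem

/-! Let `N` (`SolvedForm.parametric`) hold the coefficients of the `y^l_ν`, `l ≥ β`, in the
equations of the last class `ν`. The new unknowns are `(1 + N) y`. Since `N² = 0`, substituting `(1
- N) ȳ` for `y` inverts the change, and all three claims are read off from the coefficients after
this substitution. In class `ν` the absorbed derivatives cancel by the choice of `N`.

For an equation `f` of lower class, look at `d_ν f`: its coefficients at `y^k_{νj}` and `y^k_ν` are
those of `f` at `y^k_j` and `y^k`. By involutivity `d_ν f` is a combination of equations and
multiplicative prolongations. All of these generators except the `d_ν Φ_ν^k` satisfy the linear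
relations `consequences`, which express column `l ≥ β` through the columns below `β`. The
exceptional ones are led by `y^k_{νν}`, which is absent from `d_ν f` and from the other generators,
so `reduce` eliminates them without changing anything else. Hence `d_ν f` satisfies the relations
(`SolvedForm.eqn_apply_of_lt`), and they say exactly that `y^l` and its jets cancel from `f` after
the substitution. -/

namespace JetSystem

open Finsupp

section

/-! ### Calculus of formal derivatives. -/

variable {A : Type*} [CommRing A] {n m : ℕ} (d : Fin n → Derivation ℤ A A)

theorem formalDeriv_single (i : Fin n) (v : JetVar n m) (a : A) :
    formalDeriv d i (single v a) =
      single (v.1, v.2 + single i 1) a + single v (d i a) := by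
  exact (Finsupp.liftAddHom_apply_single _ _ _).trans (by simp)

theorem formalDeriv_apply_add_single (i : Fin n) (f : Form A n m) (k : Fin m) (μ : Fin n →₀ ℕ) :
    formalDeriv d i f (k, μ + single i 1) = f (k, μ) + d i (f (k, μ + single i 1)) := by
  classical
  induction f using Finsupp.induction_linear with
  | zero => simp
  | add f g hf hg => simp only [map_add, Finsupp.add_apply, hf, hg]; ring
  | single v a =>
    obtain ⟨k', μ'⟩ := v
    simp only [formalDeriv_single, Finsupp.add_apply, Finsupp.single_apply, Prod.mk.injEq,
      add_left_inj]
    congr 1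
    split_ifs <;> simp

theorem formalDeriv_apply_of_eq_zero (i : Fin n) (f : Form A n m) (k : Fin m) (μ : Fin n →₀ ℕ)
    (h : μ i = 0) : formalDeriv d i f (k, μ) = d i (f (k, μ)) := by
  classical
  induction f using Finsupp.induction_linear with
  | zero => simp
  | add f g hf hg => simp only [map_add, Finsupp.add_apply, hf, hg]
  | single v a =>
    obtain ⟨k', μ'⟩ := v
    have h' : μ' + single i 1 ≠ μ := by
      rintro rfl
      simp at h
    simp only [formalDeriv_single, Finsupp.add_apply, Finsupp.single_apply, Prod.mk.injEq, h',
      and_false, if_false, zero_add]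
    split_ifs <;> simp

theorem formalDeriv_smul (i : Fin n) (a : A) (f : Form A n m) :
    formalDeriv d i (a • f) = a • formalDeriv d i f + d i a • f := by
  induction f using Finsupp.induction_linear with
  | zero => simp
  | add f g hf hg => simp only [smul_add, map_add, hf, hg]; abel
  | single v b =>
    simp only [Finsupp.smul_single, formalDeriv_single, smul_eq_mul, Derivation.leibniz, smul_add,
      Finsupp.single_add, add_assoc, mul_comm b]

variable {d} in
theorem formalDeriv_commute (hd : ∀ i j a, d i (d j a) = d j (d i a)) (i j : Fin n) :
    Commute (formalDeriv d i : AddMonoid.End (Form A n m)) (formalDeriv d j) := by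
  refine Finsupp.addHom_ext fun v a => ?_
  change formalDeriv d i (formalDeriv d j (single v a)) =
    formalDeriv d j (formalDeriv d i (single v a))
  simp only [formalDeriv_single, map_add, hd i j, add_right_comm v.2 (single j 1)]
  abel

variable {d} in
theorem formalDeriv_mul_formalDerivIter (hd : ∀ i j a, d i (d j a) = d j (d i a)) (i : Fin n)
    (μ : Fin n →₀ ℕ) :
    (formalDeriv d i * formalDerivIter d μ : AddMonoid.End (Form A n m)) =
      formalDerivIter d (μ + single i 1) := by
  -- The product defining `formalDerivIter` is ordered; the extra factor `d_i` arises once, at the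
  -- entry `i`, and is moved to the front by commutativity.
  have key : ∀ L : List (Fin n), L.Nodup →
      (L.map fun j => (formalDeriv d j : AddMonoid.End (Form A n m)) ^ (μ + single i 1 : Fin n →₀ ℕ) j).prod =
        (if i ∈ L then formalDeriv d i else 1) *
          (L.map fun j => (formalDeriv d j : AddMonoid.End (Form A n m)) ^ μ j).prod := by
    intro L
    induction L with
    | nil => simp
    | cons j L ih =>
      intro hL
      rw [List.nodup_cons] at hL
      simp only [List.map_cons, List.prod_cons, ih hL.2]
      by_cases hij : i = j
      · subst hij
        simp [hL.1, pow_succ', mul_assoc]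
      · simp only [Finsupp.add_apply, Finsupp.single_apply, hij, if_false, add_zero,
          List.mem_cons, false_or]
        split_ifs
        · rw [← mul_assoc, ← mul_assoc, ((formalDeriv_commute hd i j).pow_right _).eq]
        · simp
  rw [formalDerivIter, formalDerivIter, key _ (List.nodup_finRange n)]
  simp

theorem formalDerivIter_zero : (formalDerivIter d 0 : AddMonoid.End (Form A n m)) = 1 := by
  simp [formalDerivIter]

/-! ### Substitution and linear changes of unknowns. -/

variable {d} in
theorem subst_formalDeriv (hd : ∀ i j a, d i (d j a) = d j (d i a)) (w : Fin m → Form A n m)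
    (i : Fin n) (f : Form A n m) :
    subst d w (formalDeriv d i f) = formalDeriv d i (subst d w f) := by
  induction f using Finsupp.induction_linear with
  | zero => simp
  | add f g hf hg => simp only [map_add, hf, hg]
  | single v a =>
    simp only [formalDeriv_single, map_add, subst, Finsupp.linearCombination_single,
      formalDeriv_smul, ← formalDeriv_mul_formalDerivIter hd, AddMonoid.End.coe_mul,
      Function.comp_apply]

variable {d} in
theorem formalDerivIter_single (hd : ∀ i j a, d i (d j a) = d j (d i a)) (i : Fin n) :
    (formalDerivIter d (single i 1) : AddMonoid.End (Form A n m)) = formalDeriv d i := by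
  rw [← zero_add (single i 1), ← formalDeriv_mul_formalDerivIter hd, formalDerivIter_zero, mul_one]

theorem multiIndex_induction {p : (Fin n →₀ ℕ) → Prop} (h0 : p 0)
    (hs : ∀ μ i, p μ → p (μ + single i 1)) (μ : Fin n →₀ ℕ) : p μ := by
  induction μ using Finsupp.induction with
  | zero => exact h0
  | single_add i b f _ _ ih =>
    rw [add_comm]
    clear * - ih hs
    induction b with
    | zero => simpa using ih
    | succ b ihb =>
      rw [Finsupp.single_add, ← add_assoc]
      exact hs _ _ ihb

variable {d} in
theorem subst_formalDerivIter (hd : ∀ i j a, d i (d j a) = d j (d i a)) (w : Fin m → Form A n m)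
    (μ : Fin n →₀ ℕ) (f : Form A n m) :
    subst d w (formalDerivIter d μ f) = formalDerivIter d μ (subst d w f) := by
  induction μ using multiIndex_induction with
  | h0 => simp [formalDerivIter_zero]
  | hs μ i ih =>
    simp only [← formalDeriv_mul_formalDerivIter hd, AddMonoid.End.coe_mul, Function.comp_apply,
      subst_formalDeriv hd, ih]

variable {d} in
theorem formalDerivIter_unknown (hd : ∀ i j a, d i (d j a) = d j (d i a)) (μ : Fin n →₀ ℕ)
    (k : Fin m) : formalDerivIter d μ (unknown A n k) = single (k, μ) 1 := by
  induction μ using multiIndex_induction with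
  | h0 => simp [formalDerivIter_zero, unknown]
  | hs μ i ih =>
    simp only [← formalDeriv_mul_formalDerivIter hd, AddMonoid.End.coe_mul, Function.comp_apply,
      ih, formalDeriv_single]
    simp

/-- The unknowns obtained from `y^1, …, y^m` by a linear transformation with matrix `D`. -/
noncomputable def linearUnknown (n : ℕ) (D : Matrix (Fin m) (Fin m) A) (k : Fin m) : Form A n m :=
  ∑ l, D k l • unknown A n l

theorem linearUnknown_one (k : Fin m) :
    linearUnknown n (1 : Matrix (Fin m) (Fin m) A) k = unknown A n k := by
  simp [linearUnknown, Matrix.one_apply]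

theorem linearUnknown_apply_zero (D : Matrix (Fin m) (Fin m) A) (k l : Fin m) :
    linearUnknown n D k (l, 0) = D k l := by
  simp [linearUnknown, unknown, Finsupp.finsetSum_apply, Finsupp.single_apply]

theorem linearUnknown_apply_of_ne (D : Matrix (Fin m) (Fin m) A) (k l : Fin m) {μ : Fin n →₀ ℕ}
    (h : μ ≠ 0) : linearUnknown n D k (l, μ) = 0 := by
  simp [linearUnknown, unknown, Finsupp.finsetSum_apply, h.symm]

theorem subst_unknown (w : Fin m → Form A n m) (k : Fin m) : subst d w (unknown A n k) = w k := by
  simp [subst, unknown, formalDerivIter_zero]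

theorem subst_linearUnknown (D E : Matrix (Fin m) (Fin m) A) (k : Fin m) :
    subst d (linearUnknown n D) (linearUnknown n E k) = linearUnknown n (E * D) k := by
  rw [linearUnknown]
  simp only [map_sum, map_smul, subst_unknown]
  simp only [linearUnknown, Finset.smul_sum, smul_smul, Matrix.mul_apply, Finset.sum_smul]
  exact Finset.sum_comm

-- Substitutions are `A`-linear and commute with every `d_μ`, so it suffices to compose them on the
-- unknowns, where the matrices multiply.
variable {d} in
theorem subst_subst_of_mul_eq_one (hd : ∀ i j a, d i (d j a) = d j (d i a))
    {D E : Matrix (Fin m) (Fin m) A} (h : E * D = 1) (f : Form A n m) :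
    subst d (linearUnknown n D) (subst d (linearUnknown n E) f) = f := by
  induction f using Finsupp.induction_linear with
  | zero => simp
  | add f g hf hg => simp only [map_add, hf, hg]
  | single v a =>
    have : subst d (linearUnknown n E) (single v a) =
        a • formalDerivIter d v.2 (linearUnknown n E v.1) := by
      simp [subst]
    rw [this, map_smul, subst_formalDerivIter hd, subst_linearUnknown, h, linearUnknown_one,
      formalDerivIter_unknown hd]
    simp

/-! ### Coefficients of first order expressions. -/

theorem formalDeriv_apply_zero (i : Fin n) (f : Form A n m) (k : Fin m) :
    formalDeriv d i f (k, 0) = d i (f (k, 0)) :=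
  formalDeriv_apply_of_eq_zero d i f k 0 rfl

theorem formalDeriv_apply_jet [DecidableEq (Fin n)] (i j : Fin n) (f : Form A n m) (k : Fin m) :
    formalDeriv d i f (jet k j) = (if j = i then f (k, 0) else 0) + d i (f (jet k j)) := by
  split_ifs with h
  · subst h
    have := formalDeriv_apply_add_single d j f k 0
    rwa [zero_add] at this
  · rw [formalDeriv_apply_of_eq_zero d i f k _ (by simp [h]), zero_add]

theorem eq_zero_or_eq_single_of_degree_le_one {μ : Fin n →₀ ℕ} (h : μ.degree ≤ 1) :
    μ = 0 ∨ ∃ j, μ = single j 1 := by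
  induction μ using multiIndex_induction with
  | h0 => exact Or.inl rfl
  | hs μ i _ =>
    have hμ : μ.degree = 0 := by
      simp only [map_add, Finsupp.degree_single] at h
      omega
    rw [Finsupp.degree_eq_zero_iff] at hμ
    exact Or.inr ⟨i, by rw [hμ, zero_add]⟩

theorem apply_eq_zero_of_mem_orderLE_one {f : Form A n m} (hf : f ∈ orderLE A n m 1) (k : Fin m)
    {μ : Fin n →₀ ℕ} (h0 : μ ≠ 0) (h1 : ∀ j, μ ≠ single j 1) : f (k, μ) = 0 := by
  by_contra h
  obtain h | ⟨j, h⟩ := eq_zero_or_eq_single_of_degree_le_one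
    ((Finsupp.mem_supported A f).1 hf (Finsupp.mem_support_iff.2 h))
  exacts [h0 h, h1 j h]

theorem apply_eq_zero_of_mem_orderLE {q : ℕ} {f : Form A n m} (hf : f ∈ orderLE A n m q)
    (k : Fin m) {μ : Fin n →₀ ℕ} (h : q < μ.degree) : f (k, μ) = 0 := by
  by_contra h'
  exact h.not_ge ((Finsupp.mem_supported A f).1 hf (Finsupp.mem_support_iff.2 h'))

/-- Coefficients of order zero and one determine an expression of first order. -/
theorem eq_sum_of_mem_orderLE_one {f : Form A n m} (hf : f ∈ orderLE A n m 1) :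
    f = ∑ k, (single (k, 0) (f (k, 0)) + ∑ j, single (jet k j) (f (jet k j))) := by
  classical
  ext ⟨l, μ⟩
  simp only [Finsupp.finsetSum_apply, Finsupp.add_apply, Finsupp.single_apply, Prod.mk.injEq,
    jet, ite_and]
  rw [Finset.sum_eq_single l (by intro b _ hb; simp [hb]) (by simp)]
  simp only [if_true]
  by_cases h0 : μ = 0
  · subst h0
    simp
  by_cases h1 : ∃ j, μ = single j 1
  · obtain ⟨j, rfl⟩ := h1
    simp [Finsupp.single_left_inj, Ne.symm h0]
  · push Not at h1
    rw [apply_eq_zero_of_mem_orderLE_one hf l h0 h1]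
    simp [Ne.symm h0, fun j => (h1 j).symm]

theorem classLE_le_orderLE (i : Fin n) : classLE A m i ≤ orderLE A n m 1 :=
  Finsupp.supported_mono fun v hv => by
    obtain h | ⟨j, -, h⟩ := hv <;> simp [h]

theorem apply_jet_eq_zero_of_mem_classLE {i j : Fin n} {f : Form A n m} (hf : f ∈ classLE A m i)
    (hij : i < j) (k : Fin m) : f (jet k j) = 0 := by
  by_contra h
  obtain h | ⟨j', hj', h⟩ := (Finsupp.mem_supported A f).1 hf (Finsupp.mem_support_iff.2 h)
  · simp at h
  · rw [Finsupp.single_left_inj one_ne_zero] at h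
    exact (h ▸ hij).not_ge hj'

theorem mem_classLE {i : Fin n} {f : Form A n m}
    (h : ∀ k μ, μ ≠ 0 → (∀ j ≤ i, μ ≠ single j 1) → f (k, μ) = 0) : f ∈ classLE A m i := by
  refine (Finsupp.mem_supported A f).2 fun v hv => ?_
  by_contra hv'
  simp only [Set.mem_ofPred_eq, not_or, not_exists, not_and] at hv'
  exact Finsupp.mem_support_iff.1 hv (h v.1 v.2 hv'.1 hv'.2)

/-! ### First order expressions under a linear change of unknowns. -/

variable {d} in
theorem subst_apply_of_mem_orderLE_one (hd : ∀ i j a, d i (d j a) = d j (d i a))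
    (w : Fin m → Form A n m) {f : Form A n m} (hf : f ∈ orderLE A n m 1) (v : JetVar n m) :
    subst d w f v =
      ∑ k, (f (k, 0) * w k v + ∑ j, f (jet k j) * formalDeriv d j (w k) v) := by
  conv_lhs => rw [eq_sum_of_mem_orderLE_one hf]
  simp [subst, formalDerivIter_zero, formalDerivIter_single hd, Finsupp.finsetSum_apply]

variable {d} in
theorem subst_linearUnknown_apply_zero (hd : ∀ i j a, d i (d j a) = d j (d i a))
    (D : Matrix (Fin m) (Fin m) A) {f : Form A n m} (hf : f ∈ orderLE A n m 1) (l : Fin m) :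
    subst d (linearUnknown n D) f (l, 0) =
      ∑ k, (f (k, 0) * D k l + ∑ j, f (jet k j) * d j (D k l)) := by
  simp only [subst_apply_of_mem_orderLE_one hd _ hf, formalDeriv_apply_zero,
    linearUnknown_apply_zero]

-- The derivatives of `D` only multiply undifferentiated unknowns, so each class transforms
-- separately, by `D` itself.
variable {d} in
theorem subst_linearUnknown_apply_jet (hd : ∀ i j a, d i (d j a) = d j (d i a))
    (D : Matrix (Fin m) (Fin m) A) {f : Form A n m} (hf : f ∈ orderLE A n m 1) (l : Fin m)
    (i : Fin n) :
    subst d (linearUnknown n D) f (jet l i) = ∑ k, f (jet k i) * D k l := by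
  have hi : single i 1 ≠ (0 : Fin n →₀ ℕ) := by simp
  simp only [subst_apply_of_mem_orderLE_one hd _ hf, formalDeriv_apply_jet,
    linearUnknown_apply_zero, linearUnknown_apply_of_ne D _ _ hi]
  simp

variable {d} in
theorem subst_linearUnknown_apply_of_ne (hd : ∀ i j a, d i (d j a) = d j (d i a))
    (D : Matrix (Fin m) (Fin m) A) {f : Form A n m} (hf : f ∈ orderLE A n m 1) (l : Fin m)
    {μ : Fin n →₀ ℕ} (h0 : μ ≠ 0) (h1 : ∀ j, μ ≠ single j 1) :
    subst d (linearUnknown n D) f (l, μ) = 0 := by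
  have key : ∀ j k, formalDeriv d j (linearUnknown n D k) (l, μ) = 0 := by
    intro j k
    by_cases hj : μ j = 0
    · rw [formalDeriv_apply_of_eq_zero d j _ _ _ hj, linearUnknown_apply_of_ne D _ _ h0, map_zero]
    · obtain ⟨μ', rfl⟩ : ∃ μ', μ = μ' + single j 1 :=
        ⟨μ - single j 1, (tsub_add_cancel_of_le
          (Finsupp.single_le_iff.2 (Nat.one_le_iff_ne_zero.2 hj))).symm⟩
      have hμ' : μ' ≠ 0 := by
        rintro rfl
        exact h1 j (zero_add _)
      rw [formalDeriv_apply_add_single, linearUnknown_apply_of_ne D _ _ hμ',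
        linearUnknown_apply_of_ne D _ _ h0, map_zero, add_zero]
  simp [subst_apply_of_mem_orderLE_one hd _ hf, key, linearUnknown_apply_of_ne D _ _ h0]

variable {d} in
theorem subst_linearUnknown_mem_classLE (hd : ∀ i j a, d i (d j a) = d j (d i a))
    (D : Matrix (Fin m) (Fin m) A) {i : Fin n} {f : Form A n m} (hf : f ∈ classLE A m i) :
    subst d (linearUnknown n D) f ∈ classLE A m i := by
  refine mem_classLE fun l μ h0 h1 => ?_
  by_cases h : ∃ j, μ = single j 1
  · obtain ⟨j, rfl⟩ := h
    have hij : i < j := lt_of_not_ge fun hji => h1 j hji rfl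
    refine (subst_linearUnknown_apply_jet hd D (classLE_le_orderLE i hf) l j).trans ?_
    simp [apply_jet_eq_zero_of_mem_classLE hf hij]
  · push Not at h
    exact subst_linearUnknown_apply_of_ne hd D (classLE_le_orderLE i hf) l h0 h

/-! ### Second order coefficients and elimination of `y^k_{νν}`. -/

theorem formalDeriv_apply_add_of_mem_orderLE_one (i j : Fin n) {f : Form A n m}
    (hf : f ∈ orderLE A n m 1) (k : Fin m) :
    formalDeriv d i f (k, single j 1 + single i 1) = f (jet k j) := by
  have h : f (k, single j 1 + single i 1) = 0 := apply_eq_zero_of_mem_orderLE hf k (by simp)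
  rw [formalDeriv_apply_add_single, h, map_zero, add_zero]

theorem formalDeriv_apply_add_eq_zero_of_mem_orderLE_one {i j j' : Fin n} (hj : j ≠ i)
    (hj' : j' ≠ i) {f : Form A n m} (hf : f ∈ orderLE A n m 1) (k : Fin m) :
    formalDeriv d i f (k, single j 1 + single j' 1) = 0 := by
  rw [formalDeriv_apply_of_eq_zero d i f k _ (by simp [hj, hj']),
    apply_eq_zero_of_mem_orderLE hf k (by simp), map_zero]

/-- The second order expressions that, as far as the jets of `y^l` of class `ν` and the
`y^l_{νj}` are concerned, are differential consequences of the
`y^k_ν + ∑_l N^k_l y^l_ν` with respect to the `x^j`. -/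
def consequences (ν : Fin n) (N : Matrix (Fin m) (Fin m) A) (l : Fin m) :
    Submodule A (Form A n m) where
  carrier := {h |
    (∀ j, h (l, single ν 1 + single j 1) = ∑ k, h (k, single ν 1 + single j 1) * N k l) ∧
    h (jet l ν) = ∑ k, (h (jet k ν) * N k l +
      ∑ j, h (k, single ν 1 + single j 1) * d j (N k l))}
  zero_mem' := by simp
  add_mem' := by
    rintro f g ⟨hf, hf'⟩ ⟨hg, hg'⟩
    refine ⟨fun j => ?_, ?_⟩
    · simp only [Finsupp.add_apply, hf j, hg j, add_mul, Finset.sum_add_distrib]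
    · simp only [Finsupp.add_apply, hf', hg', add_mul, Finset.sum_add_distrib]
      ring
  smul_mem' := by
    rintro a f ⟨hf, hf'⟩
    refine ⟨fun j => ?_, ?_⟩
    · simp only [Finsupp.smul_apply, smul_eq_mul, hf j, Finset.mul_sum, mul_assoc]
    · simp only [Finsupp.smul_apply, smul_eq_mul, hf', Finset.mul_sum, mul_assoc, mul_add]

theorem mem_consequences_of_mem_orderLE_one {ν : Fin n} {N : Matrix (Fin m) (Fin m) A} {l : Fin m}
    {f : Form A n m} (hf : f ∈ orderLE A n m 1)
    (h : f (jet l ν) = ∑ k, f (jet k ν) * N k l) : f ∈ consequences d ν N l := by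
  have h2 : ∀ k j, f (k, single ν 1 + single j 1) = 0 := fun k j =>
    apply_eq_zero_of_mem_orderLE hf k (by simp)
  refine ⟨fun j => ?_, ?_⟩
  · simp [h2]
  · simpa [h2] using h

/-- Subtraction of a combination of the `F k`, `k ∈ P`, with the coefficients of the `y^k_{νν}`. -/
noncomputable def reduce (ν : Fin n) (P : Finset (Fin m)) (F : Fin m → Form A n m) :
    Form A n m →ₗ[A] Form A n m :=
  LinearMap.id - ∑ k ∈ P, (Finsupp.lapply (k, single ν 1 + single ν 1)).smulRight (F k)

theorem reduce_apply (ν : Fin n) (P : Finset (Fin m)) (F : Fin m → Form A n m) (h : Form A n m) :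
    reduce ν P F h = h - ∑ k ∈ P, h (k, single ν 1 + single ν 1) • F k := by
  simp [reduce, LinearMap.sum_apply]

theorem reduce_eq_self {ν : Fin n} {P : Finset (Fin m)} {F : Fin m → Form A n m} {h : Form A n m}
    (hh : ∀ k, h (k, single ν 1 + single ν 1) = 0) : reduce ν P F h = h := by
  simp [reduce_apply, hh]

/-! ### Absorption and involutivity. -/

namespace SolvedForm

variable {S : Submodule A (Form A n m)} (Φ : SolvedForm S) (ν : Fin n) (β : ℕ)

/-- The coefficients of the `y^l_ν`, `l ≥ β`, in the equations of class `ν`. -/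
noncomputable def parametric : Matrix (Fin m) (Fin m) A := fun k l =>
  if (k : ℕ) < β ∧ β ≤ (l : ℕ) then Φ.eqn ν k (jet l ν) else 0

theorem newUnknown_eq : Φ.newUnknown ν β = linearUnknown n (1 + Φ.parametric ν β) := by
  funext k
  have : linearUnknown n (1 + Φ.parametric ν β) k =
      linearUnknown n (1 : Matrix (Fin m) (Fin m) A) k +
        ∑ l, Φ.parametric ν β k l • unknown A n l := by
    simp only [linearUnknown, Matrix.add_apply, add_smul, Finset.sum_add_distrib]
  rw [this, linearUnknown_one, newUnknown]
  split_ifs with hk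
  · simp [parametric, hk, Finset.sum_filter, ite_smul]
  · simp [parametric, hk]

/-- Nonzero entries lie in rows below `β` and columns from `β` on, so no two can be chained. -/
theorem parametric_mul_self : Φ.parametric ν β * Φ.parametric ν β = 0 := by
  ext k l
  rw [Matrix.mul_apply]
  refine Finset.sum_eq_zero fun j _ => ?_
  by_cases hj : (j : ℕ) < β
  · simp [parametric, hj]
  · simp [parametric, hj]

theorem one_add_parametric_mul : (1 + Φ.parametric ν β) * (1 - Φ.parametric ν β) = 1 := by
  simp [mul_sub, add_mul, parametric_mul_self]

theorem one_sub_parametric_mul : (1 - Φ.parametric ν β) * (1 + Φ.parametric ν β) = 1 := by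
  simp [mul_add, sub_mul, parametric_mul_self]

variable {ν β}

theorem parametric_eq_zero_of_le {k : Fin m} (hk : β ≤ (k : ℕ)) (l : Fin m) :
    Φ.parametric ν β k l = 0 := by
  simp [parametric, hk.not_gt]

theorem parametric_eq_zero_of_lt (k : Fin m) {l : Fin m} (hl : (l : ℕ) < β) :
    Φ.parametric ν β k l = 0 := by
  simp [parametric, hl.not_ge]

/-- On principal indices the solved form is a row of the identity matrix; `c` vanishes on the
others. -/
theorem sum_eqn_mul (hβ : ∀ k : Fin m, k ∈ Φ.principal ν ↔ (k : ℕ) < β) {k : Fin m}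
    (hk : k ∈ Φ.principal ν) (c : Fin m → A) (hc : ∀ l : Fin m, β ≤ (l : ℕ) → c l = 0) :
    ∑ l, Φ.eqn ν k (jet l ν) * c l = c k := by
  rw [Finset.sum_eq_single k _ (by simp)]
  · simp [Φ.eqn_solved ν k hk k hk]
  · intro l _ hl
    by_cases hlβ : (l : ℕ) < β
    · simp [Φ.eqn_solved ν k hk l ((hβ l).2 hlβ), hl]
    · rw [hc l (not_lt.1 hlβ), mul_zero]

theorem eqn_apply_eq_sum (hβ : ∀ k : Fin m, k ∈ Φ.principal ν ↔ (k : ℕ) < β) {k l : Fin m}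
    (hk : k ∈ Φ.principal ν) (hl : β ≤ (l : ℕ)) :
    Φ.eqn ν k (jet l ν) = ∑ k', Φ.eqn ν k (jet k' ν) * Φ.parametric ν β k' l := by
  rw [Φ.sum_eqn_mul hβ hk (fun k' => Φ.parametric ν β k' l)
    fun k' hk' => Φ.parametric_eq_zero_of_le hk' l]
  simp [parametric, hl, (hβ k).1 hk]

theorem eqn_mem_orderLE_one {i : Fin n} {k : Fin m} (hk : k ∈ Φ.principal i) :
    Φ.eqn i k ∈ orderLE A n m 1 :=
  classLE_le_orderLE i (Φ.eqn_mem_classLE i k hk)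

theorem le_orderLE_one (Φ : SolvedForm S) : S ≤ orderLE A n m 1 := by
  refine Φ.span_eq.symm.le.trans ?_
  refine Submodule.span_le.2 (Set.union_subset ?_ ?_)
  · rintro _ ⟨i, k, hk, rfl⟩
    exact Φ.eqn_mem_orderLE_one hk
  · exact Φ.zeroOrder_subset.trans (Finsupp.supported_mono fun v hv => by
      simp only [Set.mem_ofPred_eq] at hv ⊢
      omega)

theorem le_consequences (hmax : ∀ i, i ≤ ν)
    (hβ : ∀ k : Fin m, k ∈ Φ.principal ν ↔ (k : ℕ) < β) {l : Fin m} (hl : β ≤ (l : ℕ)) :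
    S ≤ consequences d ν (Φ.parametric ν β) l := by
  intro f hf
  refine mem_consequences_of_mem_orderLE_one d (Φ.le_orderLE_one hf) ?_
  rw [← Φ.span_eq] at hf
  induction hf using Submodule.span_induction with
  | zero => simp
  | add f g _ _ hf hg => simp only [Finsupp.add_apply, hf, hg, add_mul, Finset.sum_add_distrib]
  | smul a f _ hf => simp only [Finsupp.smul_apply, smul_eq_mul, hf, Finset.mul_sum, mul_assoc]
  | mem f hf =>
    obtain ⟨i, k, hk, rfl⟩ | hf := hf
    · obtain rfl | hi := (hmax i).eq_or_lt
      · exact Φ.eqn_apply_eq_sum hβ hk hl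
      · simp [apply_jet_eq_zero_of_mem_classLE (Φ.eqn_mem_classLE i k hk) hi]
    · have h : ∀ k, f (jet k ν) = 0 := fun k =>
        apply_eq_zero_of_mem_orderLE (Φ.zeroOrder_subset hf) k (by simp)
      simp [h]

theorem formalDeriv_eqn_mem_consequences (hβ : ∀ k : Fin m, k ∈ Φ.principal ν ↔ (k : ℕ) < β)
    {k l : Fin m} (hk : k ∈ Φ.principal ν) (hl : β ≤ (l : ℕ)) {j : Fin n} (hj : j ≠ ν) :
    formalDeriv d j (Φ.eqn ν k) ∈ consequences d ν (Φ.parametric ν β) l := by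
  classical
  have h2 : ∀ k' j', formalDeriv d j (Φ.eqn ν k) (k', single ν 1 + single j' 1) =
      if j' = j then Φ.eqn ν k (jet k' ν) else 0 := by
    intro k' j'
    split_ifs with h
    · rw [h, formalDeriv_apply_add_of_mem_orderLE_one d j ν (Φ.eqn_mem_orderLE_one hk)]
    · exact formalDeriv_apply_add_eq_zero_of_mem_orderLE_one d hj.symm h
        (Φ.eqn_mem_orderLE_one hk) k'
  refine ⟨fun j' => ?_, ?_⟩
  · simp only [h2]
    split_ifs
    · exact Φ.eqn_apply_eq_sum hβ hk hl
    · simp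
  -- For `k' < β` the coefficient differentiated is the constant `0` or `1`; otherwise row `k'` of
  -- the matrix is zero.
  · have h1 : ∀ k', formalDeriv d j (Φ.eqn ν k) (jet k' ν) * Φ.parametric ν β k' l = 0 := by
      intro k'
      by_cases hk' : (k' : ℕ) < β
      · rw [formalDeriv_apply_jet, if_neg hj.symm, Φ.eqn_solved ν k hk k' ((hβ k').2 hk')]
        split_ifs <;> simp
      · rw [Φ.parametric_eq_zero_of_le (not_lt.1 hk'), mul_zero]
    simp only [h2, h1, ite_mul, zero_mul, Finset.sum_ite_eq', Finset.mem_univ, if_true, zero_add]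
    rw [Φ.sum_eqn_mul hβ hk (fun k' => d j (Φ.parametric ν β k' l))
      fun k' hk' => by rw [Φ.parametric_eq_zero_of_le hk', map_zero],
      formalDeriv_apply_jet, if_neg hj.symm, zero_add]
    simp [parametric, hl, (hβ k).1 hk]

theorem reduce_formalDeriv_eqn {k : Fin m} (hk : k ∈ Φ.principal ν) :
    reduce ν (Φ.principal ν) (fun k => formalDeriv d ν (Φ.eqn ν k))
      (formalDeriv d ν (Φ.eqn ν k)) = 0 := by
  rw [reduce_apply, sub_eq_zero]
  simp only [formalDeriv_apply_add_of_mem_orderLE_one d ν ν (Φ.eqn_mem_orderLE_one hk)]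
  rw [Finset.sum_eq_single_of_mem k hk]
  · simp [Φ.eqn_solved ν k hk k hk]
  · intro l hl hlk
    simp [Φ.eqn_solved ν k hk l hl, hlk]

variable {d} in
theorem reduce_mem_consequences_of_mem_prolongation (hΦ : Φ.IsInvolutive d) (hmax : ∀ i, i ≤ ν)
    (hβ : ∀ k : Fin m, k ∈ Φ.principal ν ↔ (k : ℕ) < β) {l : Fin m} (hl : β ≤ (l : ℕ))
    {h : Form A n m} (hh : h ∈ prolongation d S) :
    reduce ν (Φ.principal ν) (fun k => formalDeriv d ν (Φ.eqn ν k)) h ∈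
      consequences d ν (Φ.parametric ν β) l := by
  rw [hΦ] at hh
  revert h
  change _ ≤ (consequences d ν (Φ.parametric ν β) l).comap
    (reduce ν (Φ.principal ν) fun k => formalDeriv d ν (Φ.eqn ν k))
  refine sup_le (fun f hf => ?_) (Submodule.span_le.2 ?_)
  · rw [Submodule.mem_comap, reduce_eq_self fun k =>
      apply_eq_zero_of_mem_orderLE (Φ.le_orderLE_one hf) k (by simp)]
    exact Φ.le_consequences d hmax hβ hl hf
  · rintro _ ⟨i, k, hk, j, hj, rfl⟩
    rw [SetLike.mem_coe, Submodule.mem_comap]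
    by_cases hjν : j = ν
    · subst hjν
      -- `x^ν` is multiplicative only for equations of class `ν`.
      obtain rfl : i = j := le_antisymm (hmax i) hj
      rw [Φ.reduce_formalDeriv_eqn d hk]
      exact zero_mem _
    rw [reduce_eq_self fun k' => formalDeriv_apply_add_eq_zero_of_mem_orderLE_one d
      (Ne.symm hjν) (Ne.symm hjν) (Φ.eqn_mem_orderLE_one hk) k']
    obtain rfl | hi := (hmax i).eq_or_lt
    · exact Φ.formalDeriv_eqn_mem_consequences d hβ hk hl hjν
    · have hf : ∀ k', Φ.eqn i k (jet k' ν) = 0 :=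
        apply_jet_eq_zero_of_mem_classLE (Φ.eqn_mem_classLE i k hk) hi
      have h1 : ∀ k', formalDeriv d j (Φ.eqn i k) (jet k' ν) = 0 := by
        intro k'
        rw [formalDeriv_apply_jet, if_neg (Ne.symm hjν), hf, map_zero, add_zero]
      have h2 : ∀ k' j', formalDeriv d j (Φ.eqn i k) (k', single ν 1 + single j' 1) = 0 := by
        intro k' j'
        by_cases h : j' = j
        · rw [h, formalDeriv_apply_add_of_mem_orderLE_one d j ν (Φ.eqn_mem_orderLE_one hk), hf]
        · exact formalDeriv_apply_add_eq_zero_of_mem_orderLE_one d (Ne.symm hjν) h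
            (Φ.eqn_mem_orderLE_one hk) k'
      exact ⟨fun j' => by simp [h2], by simp [h1, h2]⟩

variable {d} in
/-- The non-multiplicative prolongation of an equation of lower class with respect to the last
variable forces the coefficients of `y^l`, `l ≥ β`, to be determined by the others. -/
theorem eqn_apply_of_lt (hΦ : Φ.IsInvolutive d) (hmax : ∀ i, i ≤ ν)
    (hβ : ∀ k : Fin m, k ∈ Φ.principal ν ↔ (k : ℕ) < β) {l : Fin m} (hl : β ≤ (l : ℕ))
    {i : Fin n} (hi : i < ν) {k : Fin m} (hk : k ∈ Φ.principal i) :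
    (∀ j, Φ.eqn i k (jet l j) = ∑ k', Φ.eqn i k (jet k' j) * Φ.parametric ν β k' l) ∧
    Φ.eqn i k (l, 0) = ∑ k', (Φ.eqn i k (k', 0) * Φ.parametric ν β k' l +
      ∑ j, Φ.eqn i k (jet k' j) * d j (Φ.parametric ν β k' l)) := by
  have hf : ∀ k', Φ.eqn i k (jet k' ν) = 0 :=
    apply_jet_eq_zero_of_mem_classLE (Φ.eqn_mem_classLE i k hk) hi
  have hS : Φ.eqn i k ∈ S :=
    Φ.span_eq.le (Submodule.subset_span (Or.inl ⟨i, k, hk, rfl⟩))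
  have h1 : ∀ k', formalDeriv d ν (Φ.eqn i k) (jet k' ν) = Φ.eqn i k (k', 0) := by
    intro k'
    rw [formalDeriv_apply_jet, if_pos rfl, hf, map_zero, add_zero]
  have h2 : ∀ k' j, formalDeriv d ν (Φ.eqn i k) (k', single ν 1 + single j 1) =
      Φ.eqn i k (jet k' j) := by
    intro k' j
    rw [add_comm, formalDeriv_apply_add_of_mem_orderLE_one d ν j (Φ.eqn_mem_orderLE_one hk)]
  have h := Φ.reduce_mem_consequences_of_mem_prolongation hΦ hmax hβ hl
    (h := formalDeriv d ν (Φ.eqn i k))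
    (Submodule.mem_sup_right (Submodule.subset_span ⟨ν, _, hS, rfl⟩))
  -- A lower class equation contains no `y^k_ν`, so its `d_ν` contains no `y^k_{νν}`.
  rw [reduce_eq_self fun k' => (h2 k' ν).trans (hf k')] at h
  obtain ⟨h, h'⟩ := h
  simp only [h1, h2] at h h'
  exact ⟨h, h'⟩

end SolvedForm

end

end JetSystem

theorem proposition2p9 {A : Type*} [CommRing A] {n m : ℕ}
    (d : Fin n → Derivation ℤ A A)
    (hd : ∀ i j a, d i (d j a) = d j (d i a))
    (S : Submodule A (JetSystem.Form A n m))
    (hS : JetSystem.NoZeroOrderEquation S)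
    (Φ : JetSystem.SolvedForm S)
    (hΦ : Φ.IsInvolutive d)
    (ν : Fin n) (hν : (ν : ℕ) + 1 = n)
    (β : ℕ) (hβm : β ≤ m)
    (hβ : ∀ k : Fin m, k ∈ Φ.principal ν ↔ (k : ℕ) < β) :
    -- passing to the new unknowns is an invertible change of unknowns
    Function.Bijective (JetSystem.subst d (Φ.newUnknown ν β)) ∧
    -- `G` is the equation of the last class with index `k`, written in the new unknowns
    (∀ k ∈ Φ.principal ν, ∀ G : JetSystem.Form A n m,
      JetSystem.subst d (Φ.newUnknown ν β) G = Φ.eqn ν k →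
        G ∈ JetSystem.orderLE A n m 1 ∧
        (∀ l : Fin m, (l : ℕ) < β → G (JetSystem.jet l ν) = if l = k then 1 else 0) ∧
        (∀ (l : Fin m) (μ : Fin n →₀ ℕ), β ≤ (l : ℕ) → G (l, μ) ≠ 0 →
          μ = 0 ∨ ∃ j < ν, μ = Finsupp.single j 1)) ∧
    -- `G` is an equation of a lower class `i`, written in the new unknowns
    (∀ i < ν, ∀ k ∈ Φ.principal i, ∀ G : JetSystem.Form A n m,
      JetSystem.subst d (Φ.newUnknown ν β) G = Φ.eqn i k →
        G ∈ JetSystem.classLE A m i ∧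
        (∀ (l : Fin m) (μ : Fin n →₀ ℕ), β ≤ (l : ℕ) → G (l, μ) = 0)) := by
  have hmax : ∀ i, i ≤ ν := fun i => Fin.le_def.2 (by omega)
  set N := Φ.parametric ν β with hN
  -- The rewritten form is unique and explicit, which gives injectivity and computes every `G`
  -- below.
  have hinv : ∀ f G, JetSystem.subst d (Φ.newUnknown ν β) G = f →
      G = JetSystem.subst d (JetSystem.linearUnknown n (1 - N)) f := by
    rintro f G rfl
    rw [Φ.newUnknown_eq, JetSystem.subst_subst_of_mul_eq_one hd (Φ.one_add_parametric_mul ν β)]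
  refine ⟨⟨fun f g h => (hinv _ f h).trans (hinv _ g rfl).symm, fun f =>
    ⟨JetSystem.subst d (JetSystem.linearUnknown n (1 - N)) f, ?_⟩⟩, ?_, ?_⟩
  · rw [Φ.newUnknown_eq, JetSystem.subst_subst_of_mul_eq_one hd (Φ.one_sub_parametric_mul ν β)]
  · intro k hk G hG
    rw [hinv _ G hG]
    have hf := Φ.eqn_mem_orderLE_one hk
    have hc := JetSystem.subst_linearUnknown_mem_classLE hd (1 - N) (Φ.eqn_mem_classLE ν k hk)
    have hjet : ∀ l, JetSystem.subst d (JetSystem.linearUnknown n (1 - N)) (Φ.eqn ν k)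
        (JetSystem.jet l ν) = Φ.eqn ν k (JetSystem.jet l ν) -
          ∑ k', Φ.eqn ν k (JetSystem.jet k' ν) * N k' l := by
      intro l
      rw [JetSystem.subst_linearUnknown_apply_jet hd _ hf]
      simp [Matrix.sub_apply, mul_sub, Finset.sum_sub_distrib, Matrix.one_apply]
    refine ⟨JetSystem.classLE_le_orderLE ν hc, fun l hl => ?_, fun l μ hl hμ => ?_⟩
    · rw [hjet, Φ.eqn_solved ν k hk l ((hβ l).2 hl)]
      simp [hN, Φ.parametric_eq_zero_of_lt _ hl]
    · obtain h | ⟨j, hj, rfl⟩ := (Finsupp.mem_supported A _).1 hc (Finsupp.mem_support_iff.2 hμ)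
      · exact Or.inl h
      · refine Or.inr ⟨j, hj.lt_of_ne ?_, rfl⟩
        rintro rfl
        refine hμ ((hjet l).trans ?_)
        rw [hN, ← Φ.eqn_apply_eq_sum hβ hk hl, sub_self]
  · intro i hi k hk G hG
    rw [hinv _ G hG]
    have hf := Φ.eqn_mem_orderLE_one hk
    refine ⟨JetSystem.subst_linearUnknown_mem_classLE hd _ (Φ.eqn_mem_classLE i k hk),
      fun l μ hl => ?_⟩
    obtain ⟨h1, h0⟩ := Φ.eqn_apply_of_lt hΦ hmax hβ hl hi hk
    by_cases hμ0 : μ = 0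
    · subst hμ0
      -- Only `N` contributes derivative terms, so the new coefficient of `y^l` is the difference of
      -- the two sides of `h0`.
      have hone : ∀ j k', d j ((1 : Matrix (Fin m) (Fin m) A) k' l) = 0 := by
        intro j k'
        rw [Matrix.one_apply]
        split_ifs <;> simp
      rw [JetSystem.subst_linearUnknown_apply_zero hd _ hf]
      simp only [Matrix.sub_apply, map_sub, hone, zero_sub, mul_neg, Finset.sum_neg_distrib,
        mul_sub, ← sub_eq_add_neg, sub_sub]
      rw [Finset.sum_sub_distrib, ← h0]
      simp [Matrix.one_apply]
    by_cases hμ1 : ∃ j, μ = Finsupp.single j 1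
    · obtain ⟨j, rfl⟩ := hμ1
      refine (JetSystem.subst_linearUnknown_apply_jet hd _ hf l j).trans ?_
      simp only [Matrix.sub_apply, mul_sub, Finset.sum_sub_distrib]
      rw [← h1 j]
      simp [Matrix.one_apply]
    · push Not at hμ1
      exact JetSystem.subst_linearUnknown_apply_of_ne hd _ hf l hμ0 hμ1
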